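/- Conventions. A binary decision diagram (BDD) over a finite set $V$ of Boolean variables is a finite directed acyclic graph with one source and two sinks, labeled $0$ and $1$, in which every non-sink node is labeled with a variable of $V$ and has one outgoing $0$-edge and one outgoing $1$-edge (for constant functions the source may itself be a sink, and sinks may be unreachable). On an assignment $a$ it outputs the label of the sink reached from the source by following, at each node labeled $x$, the $a(x)$-edge. An OBDD is a BDD for which there is a linear order on $V$ such that the labels strictly increase in that order along every path. Its size is its number of nodes, and its weak width is the maximum over $x\in V$ of the number of nodes labeled $x$. For $Z\subseteq V$ and an OBDD $D$ over $V$, $\neg\exists Z\,D$ is the Boolean function on $V\setminus Z$ that is true at $a$ iff no extension of $a$ to $V$ satisfies $D$. **Lemma.** (1) There are constants $C\in\mathbb N$ and $c>0$ such that for every $n\ge 1$ there are a set $V_n$ of at most $Cn$ variables, an OBDD $D_n$ over $V_n$ of weak width $3$, and a set $Z_n\subseteq V_n$ such that every OBDD (with respect to any variable order) over $V_n\setminus Z_n$ that computes $\neg\exists Z_n\,D_n$ has size at least $2^{cn}$. In particular $\neg\exists Z_n\,D_n$ has no OBDDs of size $2^{o(n)}$. Consequently, width cannot be replaced by weak width in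 projection results for OBDDs: (2) There are no function $g:\mathbb N\to\mathbb N$ and no $k\in\mathbb N$ such that for every OBDD $D$ of weak width $w$ and every set $Z$ of its variables, $\neg\exists Z\,D$ has an OBDD of size at most $g(w)\cdot|D|^k$, where $|D|$ is the size of $D$. (3) There is no function $g:\mathbb N\to\mathbb N$ such that for every OBDD $D$ of weak width $w$ and every set $Z$ of its variables, $\neg\exists Z\,D$ has an OBDD of weak width at most $g(w)$. -/

import Mathlib

/-- A binary decision diagram over the variables `V`. `Node` is the set of decision (non-sink)
nodes, `Sum.inl u` is the decision node `u`, `Sum.inr c` is the sink labeled `c`, and `succ u b`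
is the head of the `b`-edge of `u`. The source may be a sink (so the constant functions have a
BDD), and a sink may be unreachable. -/
structure BDD (V : Type) where
  Node : Type
  finite : Finite Node
  label : Node → V
  succ : Node → Bool → Node ⊕ Bool
  source : Node ⊕ Bool
  /-- there is no directed cycle -/
  acyclic : ∀ u, ¬ Relation.TransGen (fun v w => ∃ b, succ v b = Sum.inl w) u u
  /-- no decision node other than the source is without an incoming edge -/
  single_source : ∀ w, source = Sum.inl w ∨ ∃ v b, succ v b = Sum.inl w

namespace BDD

variable {V : Type}

/-- `B.Edge v w`: some edge leads from the decision node `v` to the decision node `w`. -/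
def Edge (B : BDD V) (v w : B.Node) : Prop := ∃ b, B.succ v b = Sum.inl w

theorem wellFounded_edge (B : BDD V) : WellFounded (fun w v => B.Edge v w) := by
  have := B.finite
  let r : B.Node → B.Node → Prop := fun w v => Relation.TransGen B.Edge v w
  have : IsTrans B.Node r := ⟨fun a b c h₁ h₂ => Relation.TransGen.trans h₂ h₁⟩
  have : Std.Irrefl r := ⟨fun a h => B.acyclic a h⟩
  exact Subrelation.wf (r := r) (fun h => Relation.TransGen.single h)
    (Finite.wellFounded_of_trans_of_irrefl r)

/-- The label of the sink that is reached from the decision node `u` under the assignment `a`. -/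
def evalNode (B : BDD V) (a : V → Bool) : B.Node → Bool :=
  B.wellFounded_edge.fix fun u rec =>
    match h : B.succ u (a (B.label u)) with
    | Sum.inl w => rec w ⟨_, h⟩
    | Sum.inr c => c

/-- The label of the sink that is reached from an arbitrary node under the assignment `a`. -/
def evalFrom (B : BDD V) (a : V → Bool) : B.Node ⊕ Bool → Bool
  | Sum.inl u => B.evalNode a u
  | Sum.inr c => c

/-- The Boolean function computed by `B`. -/
def eval (B : BDD V) (a : V → Bool) : Bool := B.evalFrom a B.source

theorem evalFrom_inr (B : BDD V) (a : V → Bool) (c : Bool) :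
    B.evalFrom a (Sum.inr c) = c := rfl

theorem evalFrom_inl (B : BDD V) (a : V → Bool) (u : B.Node) :
    B.evalFrom a (Sum.inl u) = B.evalFrom a (B.succ u (a (B.label u))) := by
  change B.evalNode a u = _
  unfold evalNode
  rw [WellFounded.fix_eq]
  split <;> rename_i h
  · exact (congrArg (B.evalFrom a) h).symm
  · exact (congrArg (B.evalFrom a) h).symm

/-- The size: the number of nodes, the two sinks included. -/
noncomputable def size (B : BDD V) : ℕ := Nat.card B.Node + 2

/-- The weak width: the maximum over all variables of the number of nodes labeled with it. -/
noncomputable def weakWidth [Fintype V] (B : BDD V) : ℕ :=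
  Finset.univ.sup fun x : V => Nat.card {u : B.Node // B.label u = x}

end BDD

/-- An ordered BDD: along every edge, hence along every path, the variables strictly increase
in one fixed order, given by an injective ranking `π` of the variables. -/
structure OBDD (V : Type) extends BDD V where
  ordered : ∃ π : V → ℕ, Function.Injective π ∧
    ∀ u w b, succ u b = Sum.inl w → π (label u) < π (label w)

open Classical in
/-- The Boolean function `∃ Z f` on the variables outside `Z`. -/
noncomputable def existsProj {V : Type} (Z : Finset V) (f : (V → Bool) → Bool)
    (a : {v : V // v ∉ Z} → Bool) : Bool :=
  decide (∃ b : V → Bool, (∀ v : {v : V // v ∉ Z}, b v = a v) ∧ f b = true)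

/-- `D'` computes the function `¬ ∃ Z D`. -/
def ComputesNotExists {V : Type} (D : OBDD V) (Z : Finset V)
    (D' : OBDD {v : V // v ∉ Z}) : Prop :=
  ∀ a, D'.eval a = !(existsProj Z D.eval a)

/-!
For a bipartite graph in which every vertex carries a Boolean variable, consider the function that
is true on the independent sets, that is, when no edge has both ends set to `1`. Its negation is a
projection of a very small ordered diagram `searchDiagram`: guess a left vertex `a` with a chain
of tests of projected variables, test the variable of `a`, guess the index of a neighbour `b` with
a second such chain, test the variable of `b`. Every variable labels at most one node, however
large the in-degrees are, so the weak width is bounded while the number of variables is linear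
(`existsProj_searchDiagram`, `weakWidth_searchDiagram`). A few extra nodes that do not affect the
function bring the weak width to exactly `3`.

If the graph has an induced matching of size `n` between any half of the left vertices and any half
of the right vertices, then the independent-set function needs size `2 ^ n` for every variable
order (`OBDD.two_pow_le_size`). Cut the order where half of the left vertices have been read; one
half of the right vertices lies on one side of the cut, and this yields an induced matching across
the cut. The `2 ^ n` ways to set the matched variables before the cut lead to distinct nodes
(`BDD.two_pow_le_size`). Such a graph with linearly many edges exists
(`exists_graph_with_induced_matchings`): by counting, some graph of out-degree `20` has an edge
between any two sets that hold a quarter of the vertices on each side (`exists_expander`), and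
after discarding the few vertices of large in-degree an induced matching is found greedily.

As the size is at most the number of variables times the weak width, plus the two sinks
(`BDD.size_le_card_mul_weakWidth`), an exponential lower bound on the size rules out both
polynomial size and bounded weak width.
-/

open Finset

/-! ### Cutting an ordered diagram -/

namespace BDD

variable {V : Type}

theorem card_node_add_two (B : BDD V) : Nat.card (B.Node ⊕ Bool) = B.size := by
  have := B.finite
  rw [Nat.card_sum, size]
  simp

/-- Values are computed along paths, so after the variables of rank below `t` have been read only
the node that has been reached matters. -/
theorem exists_evalFrom_eq (B : BDD V) {π : V → ℕ} (t : ℕ) (a : V → Bool) (s : B.Node ⊕ Bool) :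
    ∃ u : B.Node ⊕ Bool,
      (∀ a' : V → Bool, (∀ v, π v < t → a' v = a v) → B.evalFrom a' s = B.evalFrom a' u) ∧
        ∀ w, u = Sum.inl w → t ≤ π (B.label w) := by
  rcases s with s | c
  · induction s using B.wellFounded_edge.induction with
    | _ s ih =>
      by_cases hs : t ≤ π (B.label s)
      · exact ⟨Sum.inl s, fun _ _ => rfl, fun w hw => by cases hw; exact hs⟩
      · push Not at hs
        rcases h : B.succ s (a (B.label s)) with w | c
        · obtain ⟨u, hu, hu'⟩ := ih w ⟨_, h⟩
          refine ⟨u, fun a' ha' => ?_, hu'⟩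
          rw [evalFrom_inl, ha' _ hs, h, hu a' ha']
        · refine ⟨Sum.inr c, fun a' ha' => ?_, by simp⟩
          rw [evalFrom_inl, ha' _ hs, h]
  · exact ⟨Sum.inr c, fun _ _ => rfl, by simp⟩

theorem evalFrom_congr (B : BDD V) {π : V → ℕ}
    (hπ : ∀ u w b, B.succ u b = Sum.inl w → π (B.label u) < π (B.label w)) {t : ℕ}
    {a a' : V → Bool} (h : ∀ v, t ≤ π v → a v = a' v) (u : B.Node ⊕ Bool)
    (hu : ∀ w, u = Sum.inl w → t ≤ π (B.label w)) : B.evalFrom a u = B.evalFrom a' u := by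
  rcases u with u | c
  · induction u using B.wellFounded_edge.induction with
    | _ u ih =>
      have hu' := hu u rfl
      rw [evalFrom_inl, evalFrom_inl, h _ hu']
      rcases hw : B.succ u (a' (B.label u)) with w | c
      · refine ih w ⟨_, hw⟩ fun w' hw' => ?_
        cases hw'
        exact hu'.trans (hπ _ _ _ hw).le
      · rfl
  · rfl

open Classical in
/-- The fooling-set bound. If the variables `p i` come before the variables `q j` and the function
tells whether the single `q j` that is set has its partner `p j` set, then distinct sets of
`p`-variables have to lead to distinct nodes. -/
theorem two_pow_le_size (B : BDD V) {π : V → ℕ}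
    (hπ : ∀ u w b, B.succ u b = Sum.inl w → π (B.label u) < π (B.label w)) (t : ℕ)
    {ι : Type} [Fintype ι] {p q : ι → V} (hp : ∀ i, π (p i) < t) (hq : ∀ i, t ≤ π (q i))
    (hB : ∀ (S : Finset ι) (j : ι),
      B.eval (fun v => decide ((∃ i ∈ S, p i = v) ∨ q j = v)) = true ↔ j ∉ S) :
    2 ^ Fintype.card ι ≤ B.size := by
  have := B.finite
  choose u hu hu' using fun S : Finset ι =>
    B.exists_evalFrom_eq (π := π) t (fun v => decide (∃ i ∈ S, p i = v)) B.source
  have huS (S : Finset ι) (j : ι) :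
      B.eval (fun v => decide ((∃ i ∈ S, p i = v) ∨ q j = v)) =
        B.evalFrom (fun v => decide (q j = v)) (u S) := by
    rw [eval, hu S]
    · refine B.evalFrom_congr hπ (fun v hv => ?_) _ (hu' S)
      have : ¬ ∃ i ∈ S, p i = v := by
        rintro ⟨i, -, rfl⟩
        exact absurd (hp i) (not_lt.2 hv)
      simp [this]
    · intro v hv
      have : q j ≠ v := by
        rintro rfl
        exact absurd hv (not_lt.2 (hq j))
      simp [this]
  have hinj : Function.Injective u := fun S T hST => by
    ext j
    rw [← not_iff_not, ← hB S j, ← hB T j, huS, huS, hST]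
  rw [← B.card_node_add_two, ← Fintype.card_finset, ← Nat.card_eq_fintype_card]
  exact Nat.card_le_card_of_injective u hinj

theorem size_le_card_mul_weakWidth [Fintype V] (B : BDD V) :
    B.size ≤ Fintype.card V * B.weakWidth + 2 := by
  classical
  have := B.finite
  have := Fintype.ofFinite B.Node
  rw [size, Nat.card_eq_fintype_card, ← Finset.card_univ (α := B.Node)]
  refine Nat.add_le_add_right ?_ 2
  rw [mul_comm, ← Finset.card_univ (α := V)]
  refine Finset.card_le_mul_card_image_of_maps_to (f := B.label) (by simp) _ fun x _ => ?_
  rw [← Fintype.card_subtype, ← Nat.card_eq_fintype_card]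
  exact Finset.le_sup (f := fun x : V => Nat.card {u : B.Node // B.label u = x}) (mem_univ x)

/-- A chain of tests `f 0, f 1, …` that is left to `x i` when `f i` is the first test to succeed,
and ends in the 0-sink if all tests fail. -/
theorem evalFrom_chain (B : BDD V) {m : ℕ} (f : Fin m → B.Node) (x : Fin m → B.Node)
    (h1 : ∀ i, B.succ (f i) true = Sum.inl (x i))
    (h0 : ∀ i, B.succ (f i) false =
      if h : i.1 + 1 < m then Sum.inl (f ⟨i.1 + 1, h⟩) else Sum.inr false)
    (a : V → Bool) (i : Fin m) :
    B.evalFrom a (Sum.inl (f i)) = true ↔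
      ∃ j, i ≤ j ∧ (∀ l, i ≤ l → l < j → a (B.label (f l)) = false) ∧
        a (B.label (f j)) = true ∧ B.evalFrom a (Sum.inl (x j)) = true := by
  obtain ⟨i, hi⟩ := i
  induction hk : m - i generalizing i with
  | zero => omega
  | succ k ih =>
    rw [evalFrom_inl]
    rcases ha : a (B.label (f ⟨i, hi⟩)) with _ | _
    · rw [h0]
      split_ifs with h
      · rw [ih (i + 1) h (by omega)]
        constructor
        · rintro ⟨j, hij, hl, hj⟩
          refine ⟨j, le_trans (by simp) hij, fun l hil hlj => ?_, hj⟩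
          rcases eq_or_lt_of_le hil with rfl | hil
          · exact ha
          · exact hl l (Nat.succ_le_of_lt hil) hlj
        · rintro ⟨j, hij, hl, hj, hx⟩
          refine ⟨j, ?_, fun l hil hlj => hl l (le_trans (by simp) hil) hlj, hj, hx⟩
          rcases eq_or_lt_of_le hij with rfl | hij
          · simp [ha] at hj
          · exact Nat.succ_le_of_lt hij
      · simp only [evalFrom_inr, Bool.false_eq_true, false_iff]
        rintro ⟨j, hij, -, hj, -⟩
        have : (⟨i, hi⟩ : Fin m) = j := Fin.ext (by
          have h₁ : ¬ i + 1 < m := h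
          have h₂ := j.2
          have h₃ : i ≤ j.1 := hij
          change i = j.1
          omega)
        simp [← this, ha] at hj
    · rw [h1]
      constructor
      · intro h
        exact ⟨_, le_rfl, fun l h1 h2 => absurd h1 (not_le.2 h2), ha, h⟩
      · rintro ⟨j, hij, hl, hj, hx⟩
        rcases eq_or_lt_of_le hij with rfl | hij
        · exact hx
        · have := hl _ le_rfl hij
          simp [ha] at this

end BDD

/-! ### Expanding bipartite graphs and induced matchings -/

/-- Counting: fewer than `(8 q) ^ (160 q)` of the maps miss an edge between some `A` and `B`,
because `4 ^ (8 q) * (6 q) ^ (40 q) < (8 q) ^ (40 q)`. -/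
theorem exists_expander (q : ℕ) (hq : 0 < q) :
    ∃ h : Fin (8 * q) × Fin 20 → Fin (8 * q), ∀ A B : Finset (Fin (8 * q)),
      2 * q ≤ #A → 2 * q ≤ #B → ∃ a ∈ A, ∃ i, h (a, i) ∈ B := by
  classical
  -- the maps without an edge between `AB.1` and `AB.2`
  let bad (AB : Finset (Fin (8 * q)) × Finset (Fin (8 * q))) :
      Finset (Fin (8 * q) × Fin 20 → Fin (8 * q)) :=
    Fintype.piFinset fun e => if e.1 ∈ AB.1 then AB.2ᶜ else univ
  let pairs := powersetCard (2 * q) (univ : Finset (Fin (8 * q))) ×ˢ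
    powersetCard (2 * q) (univ : Finset (Fin (8 * q)))
  have hbad : ∀ AB ∈ pairs, #(bad AB) ≤ (6 * q) ^ (40 * q) * (8 * q) ^ (120 * q) := by
    rintro ⟨A, B⟩ hAB
    simp only [pairs, mem_product, mem_powersetCard, subset_univ, true_and] at hAB
    have hAc : #Aᶜ = 6 * q := by rw [card_compl, hAB.1, Fintype.card_fin]; omega
    have hBc : #Bᶜ = 6 * q := by rw [card_compl, hAB.2, Fintype.card_fin]; omega
    let w (a : Fin (8 * q)) : ℕ := if a ∈ A then 6 * q else 8 * q
    have hcard : #(bad (A, B)) = ∏ e : Fin (8 * q) × Fin 20, w e.1 := by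
      rw [Fintype.card_piFinset]
      refine prod_congr rfl fun e _ => ?_
      by_cases he : e.1 ∈ A <;> simp [w, he, hBc]
    rw [hcard, Fintype.prod_prod_type]
    simp only [prod_const, card_univ, Fintype.card_fin]
    rw [prod_pow, ← prod_mul_prod_compl A,
      prod_congr rfl (g := fun _ => 6 * q) (fun a ha => by simp [w, ha]),
      prod_congr (s₁ := Aᶜ) rfl (g := fun _ => 8 * q) (fun a ha => by simp [w, mem_compl.1 ha]),
      prod_const, prod_const, hAB.1, hAc, mul_pow, ← pow_mul, ← pow_mul]
    apply le_of_eq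
    ring_nf
  have hpairs : #pairs ≤ 4 ^ (8 * q) := by
    have h : #(powersetCard (2 * q) (univ : Finset (Fin (8 * q)))) ≤ 2 ^ (8 * q) :=
      (card_le_univ _).trans (by simp)
    rw [card_product, show 4 = 2 * 2 from rfl, mul_pow]
    exact Nat.mul_le_mul h h
  have hlt : #(pairs.biUnion bad) < #(univ : Finset (Fin (8 * q) × Fin 20 → Fin (8 * q))) := by
    refine (card_biUnion_le_card_mul _ _ _ hbad).trans_lt ?_
    refine (Nat.mul_le_mul_right _ hpairs).trans_lt ?_
    rw [card_univ, Fintype.card_fun, Fintype.card_prod, Fintype.card_fin, Fintype.card_fin,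
      show 8 * q * 20 = 40 * q + 120 * q by ring, pow_add, ← mul_assoc]
    refine Nat.mul_lt_mul_of_pos_right ?_ (by positivity)
    rw [show 40 * q = 5 * (8 * q) by ring, pow_mul (6 * q), pow_mul (8 * q), ← mul_pow]
    refine Nat.pow_lt_pow_left ?_ (by omega)
    have : 0 < q ^ 5 := by positivity
    calc 4 * (6 * q) ^ 5 = 31104 * q ^ 5 := by ring
      _ < 32768 * q ^ 5 := by omega
      _ = (8 * q) ^ 5 := by ring
  obtain ⟨h, -, hh⟩ := exists_mem_notMem_of_card_lt_card hlt
  refine ⟨h, fun A B hA hB => ?_⟩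
  obtain ⟨A', hA', hcA⟩ := exists_subset_card_eq hA
  obtain ⟨B', hB', hcB⟩ := exists_subset_card_eq hB
  by_contra! hcon
  refine hh (mem_biUnion.2 ⟨(A', B'), by simp [pairs, hcA, hcB], ?_⟩)
  refine Fintype.mem_piFinset.2 fun e => ?_
  by_cases he : e.1 ∈ A'
  · simpa [he] using fun hb => hcon _ (hA' he) e.2 (hB' hb)
  · simp [he]

/-- The finite set `P` of edges of the bipartite graph `r` is an induced matching: no edge
joins the left end of one of its members to the right end of another. -/
def IsInducedMatching {α β : Type} (r : α → β → Prop) (P : Finset (α × β)) : Prop :=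
  ∀ e ∈ P, ∀ e' ∈ P, r e.1 e'.2 ↔ e = e'

/-- Edges are chosen greedily; each choice costs at most `d` vertices on either side. -/
theorem exists_isInducedMatching {α β : Type} (r : α → β → Prop) [DecidableRel r] (s d n : ℕ)
    (A : Finset α) (B : Finset β) (hA : ∀ a ∈ A, #{b ∈ B | r a b} ≤ d)
    (hB : ∀ b ∈ B, #{a ∈ A | r a b} ≤ d)
    (hr : ∀ A' ⊆ A, ∀ B' ⊆ B, s ≤ #A' → s ≤ #B' → ∃ a ∈ A', ∃ b ∈ B', r a b)
    (hcA : s + n * d ≤ #A) (hcB : s + n * d ≤ #B) :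
    ∃ P : Finset (α × β), #P = n ∧ P ⊆ A ×ˢ B ∧ IsInducedMatching r P := by
  classical
  induction n generalizing A B with
  | zero => exact ⟨∅, by simp, by simp, by simp [IsInducedMatching]⟩
  | succ n ih =>
    rw [add_mul, one_mul] at hcA hcB
    obtain ⟨a, ha, b, hb, hab⟩ := hr A subset_rfl B subset_rfl (by omega) (by omega)
    have h1 := card_filter_add_card_filter_not (s := A) (r · b)
    have h2 := card_filter_add_card_filter_not (s := B) (r a ·)
    have h3 := hA a ha
    have h4 := hB b hb
    obtain ⟨P, hP, hPAB, hind⟩ := ih {a' ∈ A | ¬ r a' b} {b' ∈ B | ¬ r a b'}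
      (fun a' ha' => (card_le_card (filter_subset_filter _ (filter_subset _ _))).trans
        (hA a' (mem_filter.1 ha').1))
      (fun b' hb' => (card_le_card (filter_subset_filter _ (filter_subset _ _))).trans
        (hB b' (mem_filter.1 hb').1))
      (fun A' hA' B' hB' => hr A' (hA'.trans (filter_subset _ _)) B'
        (hB'.trans (filter_subset _ _)))
      (by omega) (by omega)
    have hmem : ∀ e ∈ P, (e.1 ∈ A ∧ ¬ r e.1 b) ∧ e.2 ∈ B ∧ ¬ r a e.2 := fun e he => by
      simpa using hPAB he
    have hnot : (a, b) ∉ P := fun h => (hmem _ h).1.2 hab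
    refine ⟨insert (a, b) P, by rw [card_insert_of_notMem hnot, hP], ?_, ?_⟩
    · intro e he
      rcases mem_insert.1 he with rfl | he
      · exact mem_product.2 ⟨ha, hb⟩
      · exact mem_product.2 ⟨(hmem e he).1.1, (hmem e he).2.1⟩
    · intro e he e' he'
      rcases mem_insert.1 he with rfl | he <;> rcases mem_insert.1 he' with rfl | he'
      · simpa using hab
      · exact iff_of_false (hmem e' he').2.2 fun h => hnot (h ▸ he')
      · exact iff_of_false (hmem e he).1.2 fun h => hnot (h ▸ he)
      · exact hind e he e' he'

/-- A bipartite graph of bounded out-degree with large induced matchings between any two halves.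
Of the 21 neighbours of `a` one is `a` itself, which makes every right vertex a neighbour; the
others come from an expander. At most `168 n` right vertices have in-degree above `168`; the
matchings avoid these. -/
theorem exists_graph_with_induced_matchings (n : ℕ) (hn : 1 ≤ n) :
    ∃ N : Fin (1344 * n) → Fin 21 → Fin (1344 * n), (∀ b, ∃ a i, N a i = b) ∧
      ∀ A B : Finset (Fin (1344 * n)), 672 * n ≤ #A → 672 * n ≤ #B →
        ∃ P : Finset (Fin (1344 * n) × Fin (1344 * n)), #P = n ∧ P ⊆ A ×ˢ B ∧
          IsInducedMatching (fun a b => ∃ i, N a i = b) P := by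
  classical
  rw [show 1344 * n = 8 * (168 * n) by ring]
  obtain ⟨h, hh⟩ := exists_expander (168 * n) (by omega)
  let N (a : Fin (8 * (168 * n))) : Fin 21 → Fin (8 * (168 * n)) := Fin.cons a fun i => h (a, i)
  let r (a b : Fin (8 * (168 * n))) : Prop := ∃ i, N a i = b
  refine ⟨N, fun b => ⟨b, 0, rfl⟩, fun A B hA hB => ?_⟩
  change ∃ P, #P = n ∧ P ⊆ A ×ˢ B ∧ IsInducedMatching r P
  have hout (a) (B : Finset (Fin (8 * (168 * n)))) : #{b ∈ B | r a b} ≤ 21 := by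
    have hsub : {b ∈ B | r a b} ⊆ univ.image (N a) := fun b hb => by
      simpa [r] using (mem_filter.1 hb).2
    exact (card_le_card hsub).trans (card_image_le.trans (by simp))
  have hhigh : #{b ∈ B | ¬ #{a ∈ A | r a b} ≤ 168} ≤ 168 * n := by
    have := card_mul_le_card_mul' (s := univ) (t := {b ∈ B | ¬ #{a ∈ A | r a b} ≤ 168}) r
      (m := 21) (n := 168) ?_ ?_
    · simp only [card_univ, Fintype.card_fin] at this
      omega
    · intro b hb
      refine (not_le.1 (mem_filter.1 hb).2).le.trans (card_le_card ?_)
      exact filter_subset_filter _ (subset_univ _)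
    · exact fun a _ => hout a _
  have hsplit := card_filter_add_card_filter_not (s := B) fun b => #{a ∈ A | r a b} ≤ 168
  obtain ⟨P, hP, hPAB, hind⟩ := exists_isInducedMatching r (2 * (168 * n)) 168 n A
    {b ∈ B | #{a ∈ A | r a b} ≤ 168} (fun a _ => (hout a _).trans (by norm_num))
    (fun b hb => (mem_filter.1 hb).2)
    (fun A' _ B' _ hA' hB' => by
      obtain ⟨a, ha, i, hi⟩ := hh A' B' hA' hB'
      exact ⟨a, ha, _, hi, i.succ, by simp [N]⟩)
    (by omega) (by omega)
  exact ⟨P, hP, hPAB.trans (product_subset_product_right (filter_subset _ _)), hind⟩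

/-! ### The lower bound for independent sets -/

theorem exists_card_filter_lt_eq {α : Type} [Fintype α] {f : α → ℕ} (hf : Function.Injective f)
    (h : ℕ) (hh : h ≤ Fintype.card α) : ∃ t, #{a | f a < t} = h := by
  classical
  induction h with
  | zero => exact ⟨0, by simp⟩
  | succ h ih =>
    obtain ⟨t, ht⟩ := ih (by omega)
    have hne : ({a | ¬ f a < t} : Finset α).Nonempty := by
      rw [← card_pos]
      have := card_filter_add_card_filter_not (s := (univ : Finset α)) (f · < t)
      rw [card_univ] at this
      omega
    obtain ⟨a, ha, hmin⟩ := exists_min_image _ f hne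
    simp only [mem_filter, mem_univ, true_and, not_lt] at ha hmin
    refine ⟨f a + 1, ?_⟩
    rw [← ht, ← card_insert_of_notMem (s := {a | f a < t}) (a := a) (by simpa using ha)]
    congr 1
    ext b
    simp only [mem_filter, mem_univ, true_and, mem_insert]
    constructor
    · intro hb
      by_contra! hcon
      have h1 := hmin b hcon.2
      exact hcon.1 (hf (by omega))
    · rintro (rfl | hb) <;> omega

/-- An ordered diagram that recognizes the independent sets of a bipartite graph with induced
matchings of size `n` between any two halves has size at least `2 ^ n`: the order is cut where
half of the left vertices have been read. -/
theorem OBDD.two_pow_le_size {V : Type} (D : OBDD V) {h n : ℕ}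
    {r : Fin (2 * h) → Fin (2 * h) → Prop}
    (hr : ∀ A B : Finset (Fin (2 * h)), h ≤ #A → h ≤ #B →
      ∃ P : Finset (Fin (2 * h) × Fin (2 * h)), #P = n ∧ P ⊆ A ×ˢ B ∧ IsInducedMatching r P)
    {X Y : Fin (2 * h) → V} (hX : Function.Injective X) (hY : Function.Injective Y)
    (hXY : ∀ a b, X a ≠ Y b)
    (hD : ∀ w, D.eval w = true ↔ ∀ a b, r a b → ¬ (w (X a) = true ∧ w (Y b) = true)) :
    2 ^ n ≤ D.size := by
  classical
  obtain ⟨π, hπ, hord⟩ := D.ordered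
  obtain ⟨t, ht⟩ := exists_card_filter_lt_eq (hπ.comp hX) h (by simp; omega)
  have ht' := card_filter_add_card_filter_not (s := univ) fun a => (π ∘ X) a < t
  have hs := card_filter_add_card_filter_not (s := univ) fun a => (π ∘ Y) a < t
  rw [card_univ, Fintype.card_fin] at ht' hs
  -- Either half of the right vertices come after the cut, to be matched with the left vertices
  -- before it, or half of them come before the cut.
  rcases le_or_gt h #{a | ¬ (π ∘ Y) a < t} with hc | hc
  · obtain ⟨P, hP, hPAB, hind⟩ := hr _ _ ht.ge hc
    have hmem : ∀ e : P, π (X e.1.1) < t ∧ t ≤ π (Y e.1.2) := fun e => by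
      simpa using hPAB e.2
    rw [← hP, ← Fintype.card_coe]
    refine D.toBDD.two_pow_le_size hord t (p := fun e : P => X e.1.1) (q := fun e : P => Y e.1.2)
      (fun e => (hmem e).1) (fun e => (hmem e).2) fun S j => ?_
    simp only [hD, decide_eq_true_eq, hX.eq_iff, hY.eq_iff, hXY, (hXY _ _).symm, or_false,
      exists_false, and_false, false_or]
    constructor
    · intro H hj
      exact H j.1.1 j.1.2 ((hind _ j.2 _ j.2).2 rfl) ⟨⟨j, hj, rfl⟩, rfl⟩
    · rintro hj _ _ hab ⟨⟨i, hi, rfl⟩, rfl⟩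
      exact hj (Subtype.ext ((hind _ i.2 _ j.2).1 hab) ▸ hi)
  · obtain ⟨P, hP, hPAB, hind⟩ := hr {a | ¬ (π ∘ X) a < t} {b | (π ∘ Y) b < t} (by omega)
      (by omega)
    have hmem : ∀ e : P, t ≤ π (X e.1.1) ∧ π (Y e.1.2) < t := fun e => by
      simpa using hPAB e.2
    rw [← hP, ← Fintype.card_coe]
    refine D.toBDD.two_pow_le_size hord t (p := fun e : P => Y e.1.2) (q := fun e : P => X e.1.1)
      (fun e => (hmem e).2) (fun e => (hmem e).1) fun S j => ?_
    simp only [hD, decide_eq_true_eq, hX.eq_iff, hY.eq_iff, hXY, (hXY _ _).symm, or_false,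
      exists_false, and_false, false_or]
    constructor
    · intro H hj
      exact H j.1.1 j.1.2 ((hind _ j.2 _ j.2).2 rfl) ⟨rfl, ⟨j, hj, rfl⟩⟩
    · rintro hj _ _ hab ⟨rfl, ⟨i, hi, rfl⟩⟩
      exact hj (Subtype.ext ((hind _ j.2 _ i.2).1 hab).symm ▸ hi)

/-! ### A diagram of weak width 3 that hides the independent-set function -/

/-- The nodes of the diagram for the bipartite graph in which `N a` lists the neighbours of the
left vertex `a`. The tests `pick a` guess a left vertex, `left a` reads its variable, the tests
`pickNbr a i` guess one of its neighbours, and `right b` reads the variable of that neighbour.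
The nodes `top` and `pad` stand before the rest: all `pad` nodes are labeled with one variable,
which brings the weak width to `3` without changing the function. -/
inductive SearchNode (M K : ℕ) where
  | top (i : Fin 2)
  | pad (j : Fin 3)
  | pick (a : Fin M)
  | left (a : Fin M)
  | pickNbr (a : Fin M) (i : Fin K)
  | right (b : Fin M)

namespace SearchNode

variable {M K : ℕ}

/-- The number of the variable that is tested at a node; variables are tested in the order of
their numbers. -/
def rank : SearchNode M K → ℕ
  | top i => i
  | pad _ => 2
  | pick a => 3 + a
  | left a => 3 + M + a
  | pickNbr a i => 3 + 2 * M + finProdFinEquiv (a, i)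
  | right b => 3 + 2 * M + M * K + b

/-- A tag that tells apart the nodes with the same label. -/
def tag : SearchNode M K → Fin 3
  | pad j => j
  | _ => 0

theorem rank_lt (u : SearchNode M K) : u.rank < 3 + 3 * M + M * K := by
  cases u with
  | pickNbr a i => have := (finProdFinEquiv (a, i)).2; simp only [rank]; omega
  | _ => simp only [rank]; omega

theorem eq_of_rank_eq_of_tag_eq {u v : SearchNode M K} (h : u.rank = v.rank) (ht : u.tag = v.tag) :
    u = v := by
  have key (a : Fin M) (i : Fin K) := (finProdFinEquiv (a, i)).2
  cases u with
  | pickNbr a i =>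
    have := key a i
    cases v with
    | pickNbr a' i' =>
      have h' : finProdFinEquiv (a, i) = finProdFinEquiv (a', i') :=
        Fin.ext (Nat.add_left_cancel h)
      have := finProdFinEquiv.injective h'
      simp_all
    | _ => simp only [rank] at h; omega
  | _ =>
    cases v with
    | pickNbr a' i' => have := key a' i'; simp only [rank] at h; omega
    | _ =>
      simp only [rank, tag] at h ht
      first
      | omega
      | (congr 1 <;> omega)

/-- The variable tested at a node. -/
def label (u : SearchNode M K) : Fin (3 + 3 * M + M * K) := ⟨u.rank, u.rank_lt⟩

theorem injective_label_tag :
    Function.Injective fun u : SearchNode M K => (u.label, u.tag) := fun u v h => by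
  simp only [Prod.mk.injEq, label, Fin.mk.injEq] at h
  exact eq_of_rank_eq_of_tag_eq h.1 h.2

theorem eq_of_label_eq {u v : SearchNode M K} (h : u.label = v.label) (ht : u.tag = v.tag) :
    u = v :=
  injective_label_tag (Prod.ext h ht)

instance : Finite (SearchNode M K) := Finite.of_injective _ injective_label_tag

/-- The guessing variables, those of the tests before `left` and between `left` and `right`. -/
def guessVars (M K : ℕ) : Finset (Fin (3 + 3 * M + M * K)) :=
  {v | v.1 < 3 + M ∨ 3 + 2 * M ≤ v.1 ∧ v.1 < 3 + 2 * M + M * K}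

/-- The free variable of a left vertex. -/
def leftVar (a : Fin M) : {v : Fin (3 + 3 * M + M * K) // v ∉ guessVars M K} :=
  ⟨label (left a), by simp only [guessVars, mem_filter, mem_univ, label, rank]; omega⟩

/-- The free variable of a right vertex. -/
def rightVar (b : Fin M) : {v : Fin (3 + 3 * M + M * K) // v ∉ guessVars M K} :=
  ⟨label (right b), by simp only [guessVars, mem_filter, mem_univ, label, rank]; omega⟩

theorem leftVar_injective : Function.Injective (leftVar (M := M) (K := K)) := fun a b h => by
  simpa using eq_of_label_eq (congrArg Subtype.val h) rfl

theorem rightVar_injective : Function.Injective (rightVar (M := M) (K := K)) := fun a b h => by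
  simpa using eq_of_label_eq (congrArg Subtype.val h) rfl

theorem leftVar_ne_rightVar (a b : Fin M) : leftVar (K := K) a ≠ rightVar b := fun h => by
  simpa using eq_of_label_eq (congrArg Subtype.val h) rfl

variable [NeZero M] [NeZero K]

/-- The outgoing edges of a node. -/
def succ (N : Fin M → Fin K → Fin M) : SearchNode M K → Bool → SearchNode M K ⊕ Bool
  | top 0, false => Sum.inl (pad 0)
  | top 0, true => Sum.inl (top 1)
  | top 1, false => Sum.inl (pad 1)
  | top 1, true => Sum.inl (pad 2)
  | pad _, _ => Sum.inl (pick 0)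
  | pick a, false => if h : a.1 + 1 < M then Sum.inl (pick ⟨a.1 + 1, h⟩) else Sum.inr false
  | pick a, true => Sum.inl (left a)
  | left _, false => Sum.inr false
  | left a, true => Sum.inl (pickNbr a 0)
  | pickNbr a i, false =>
      if h : i.1 + 1 < K then Sum.inl (pickNbr a ⟨i.1 + 1, h⟩) else Sum.inr false
  | pickNbr a i, true => Sum.inl (right (N a i))
  | right _, b => Sum.inr b

theorem rank_lt_rank_of_succ_eq (N : Fin M → Fin K → Fin M) (u w : SearchNode M K) (b : Bool)
    (h : succ N u b = Sum.inl w) : u.rank < w.rank := by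
  have key (a : Fin M) (i : Fin K) := (finProdFinEquiv (a, i)).2
  cases u with
  | top i =>
    fin_cases i <;> cases b <;> cases h <;> simp [rank]
  | pad j => cases h; simp [rank]
  | pick a =>
    cases b
    · simp only [succ] at h
      split_ifs at h
      cases h
      simp [rank]
    · cases h
      simp only [rank]
      omega
  | left a =>
    cases b <;> cases h
    simp only [rank]
    omega
  | pickNbr a i =>
    cases b
    · simp only [succ] at h
      split_ifs at h
      cases h
      simp [rank]
    · cases h
      have := key a i
      simp only [rank]
      omega
  | right c => cases h

end SearchNode

section SearchDiagram

open SearchNode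

variable {M K : ℕ} [NeZero M] [NeZero K]

/-- The diagram that searches for an edge with both ends set to `1`. -/
def searchDiagram (N : Fin M → Fin K → Fin M) (hN : ∀ b, ∃ a i, N a i = b) :
    OBDD (Fin (3 + 3 * M + M * K)) where
  Node := SearchNode M K
  finite := inferInstance
  label := SearchNode.label
  succ := SearchNode.succ N
  source := Sum.inl (top 0)
  acyclic := by
    have hlt : ∀ u v : SearchNode M K,
        Relation.TransGen (fun v w => ∃ b, SearchNode.succ N v b = Sum.inl w) u v →
          u.rank < v.rank := fun u v h => by
      induction h with
      | single h => obtain ⟨b, h⟩ := h; exact rank_lt_rank_of_succ_eq N _ _ b h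
      | tail _ h ih => obtain ⟨b, h⟩ := h; exact ih.trans (rank_lt_rank_of_succ_eq N _ _ b h)
    exact fun u h => (hlt u u h).false
  single_source := by
    intro w
    cases w with
    | top i =>
      fin_cases i
      · exact Or.inl rfl
      · exact Or.inr ⟨top 0, true, rfl⟩
    | pad j =>
      fin_cases j
      · exact Or.inr ⟨top 0, false, rfl⟩
      · exact Or.inr ⟨top 1, false, rfl⟩
      · exact Or.inr ⟨top 1, true, rfl⟩
    | pick a =>
      right
      obtain ⟨a, ha⟩ := a
      cases a with
      | zero => exact ⟨pad 0, true, rfl⟩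
      | succ a => exact ⟨pick ⟨a, by omega⟩, false, by simp [SearchNode.succ, ha]⟩
    | left a => exact Or.inr ⟨pick a, true, rfl⟩
    | pickNbr a i =>
      right
      obtain ⟨i, hi⟩ := i
      cases i with
      | zero => exact ⟨left a, true, rfl⟩
      | succ i => exact ⟨pickNbr a ⟨i, by omega⟩, false, by simp [SearchNode.succ, hi]⟩
    | right b =>
      obtain ⟨a, i, h⟩ := hN b
      exact Or.inr ⟨pickNbr a i, true, by simp [SearchNode.succ, h]⟩
  ordered := ⟨Fin.val, Fin.val_injective, rank_lt_rank_of_succ_eq N⟩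

variable (N : Fin M → Fin K → Fin M) (hN : ∀ b, ∃ a i, N a i = b)

theorem weakWidth_searchDiagram : (searchDiagram N hN).weakWidth = 3 := by
  apply le_antisymm
  · refine Finset.sup_le fun x _ => ?_
    refine (Nat.card_le_card_of_injective
      (fun u : {u : SearchNode M K // u.label = x} => u.1.tag) fun u v h => ?_).trans_eq
        (Nat.card_fin 3)
    exact Subtype.ext (eq_of_label_eq (u.2.trans v.2.symm) h)
  · refine le_trans ?_ (Finset.le_sup (f := fun x => Nat.card
      {u : SearchNode M K // u.label = x}) (mem_univ (label (pad 0))))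
    refine (Nat.card_fin 3).ge.trans
      (Nat.card_le_card_of_injective (fun j => ⟨pad j, rfl⟩) fun i j h => ?_)
    exact pad.inj (congrArg Subtype.val h)

theorem evalFrom_searchDiagram (w : Fin (3 + 3 * M + M * K) → Bool) (u : SearchNode M K) :
    (searchDiagram N hN).evalFrom w (Sum.inl u) =
      (searchDiagram N hN).evalFrom w (SearchNode.succ N u (w u.label)) :=
  (searchDiagram N hN).evalFrom_inl w u

theorem eval_searchDiagram (w : Fin (3 + 3 * M + M * K) → Bool) :
    (searchDiagram N hN).eval w = (searchDiagram N hN).evalFrom w (Sum.inl (pick 0)) := by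
  have hpad (j : Fin 3) : (searchDiagram N hN).evalFrom w (Sum.inl (pad j)) =
      (searchDiagram N hN).evalFrom w (Sum.inl (pick 0)) :=
    evalFrom_searchDiagram N hN w _
  refine (evalFrom_searchDiagram N hN w (top 0)).trans ?_
  rcases w (label (top 0 : SearchNode M K)) with _ | _
  · exact hpad 0
  · refine (evalFrom_searchDiagram N hN w (top 1)).trans ?_
    rcases w (label (top 1 : SearchNode M K)) with _ | _
    · exact hpad 1
    · exact hpad 2

theorem evalFrom_left_searchDiagram (w : Fin (3 + 3 * M + M * K) → Bool) (a : Fin M) :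
    (searchDiagram N hN).evalFrom w (Sum.inl (left a)) = true ↔
      w (label (left a : SearchNode M K)) = true ∧
        (searchDiagram N hN).evalFrom w (Sum.inl (pickNbr a 0)) = true := by
  rw [evalFrom_searchDiagram]
  rcases w (label (left a : SearchNode M K)) with _ | _
  · exact iff_of_false Bool.false_ne_true fun h => Bool.false_ne_true h.1
  · exact ⟨fun h => ⟨rfl, h⟩, And.right⟩

theorem evalFrom_right_searchDiagram (w : Fin (3 + 3 * M + M * K) → Bool) (b : Fin M) :
    (searchDiagram N hN).evalFrom w (Sum.inl (right b)) = w (label (right b : SearchNode M K)) :=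
  evalFrom_searchDiagram N hN w _

/-- An edge with both ends set to `1` can be guessed: the two guessing chains are left at its
left end and at the index of its right end. Conversely every accepting path passes one. -/
theorem existsProj_searchDiagram (w : {v : Fin (3 + 3 * M + M * K) // v ∉ guessVars M K} → Bool) :
    existsProj (guessVars M K) (searchDiagram N hN).eval w = true ↔
      ∃ a b, (∃ i, N a i = b) ∧ w (leftVar a) = true ∧ w (rightVar b) = true := by
  have hpick (v a) := (searchDiagram N hN).evalFrom_chain (m := M) pick left (fun _ => rfl)
    (fun _ => rfl) v a
  have hnbr (v a i) := (searchDiagram N hN).evalFrom_chain (m := K) (pickNbr a)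
    (fun i => right (N a i)) (fun _ => rfl) (fun _ => rfl) v i
  simp only [existsProj, decide_eq_true_eq, eval_searchDiagram]
  constructor
  · rintro ⟨v, hv, h⟩
    obtain ⟨a, -, -, -, h⟩ := (hpick v 0).1 h
    obtain ⟨ha, h⟩ := (evalFrom_left_searchDiagram N hN v a).1 h
    obtain ⟨i, -, -, -, h⟩ := (hnbr v a 0).1 h
    rw [evalFrom_right_searchDiagram] at h
    exact ⟨a, N a i, ⟨i, rfl⟩, (hv (leftVar a)).symm.trans ha,
      (hv (rightVar (N a i))).symm.trans h⟩
  · rintro ⟨a, _, ⟨i, rfl⟩, ha, hb⟩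
    let v (x : Fin (3 + 3 * M + M * K)) : Bool := if hx : x ∈ guessVars M K then
      decide (x = label (pick a : SearchNode M K) ∨ x = label (pickNbr a i)) else w ⟨x, hx⟩
    have hv (x : {v : Fin (3 + 3 * M + M * K) // v ∉ guessVars M K}) : v x = w x := by
      simp [v, x.2]
    have hv1 (a' : Fin M) : v (label (pick a' : SearchNode M K)) = decide (a' = a) := by
      have hmem : label (pick a' : SearchNode M K) ∈ guessVars M K := by
        simp only [guessVars, mem_filter, mem_univ, true_and, label, rank]
        omega
      have h1 : label (pick a' : SearchNode M K) = label (pick a : SearchNode M K) ↔ a' = a :=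
        ⟨fun h => by simpa using eq_of_label_eq h rfl, fun h => h ▸ rfl⟩
      have h2 : label (pick a' : SearchNode M K) ≠ label (pickNbr a i) :=
        fun h => by simpa using eq_of_label_eq h rfl
      simp [v, hmem, h1, h2]
    have hv2 (i' : Fin K) : v (label (pickNbr a i')) = decide (i' = i) := by
      have hmem : label (pickNbr a i') ∈ guessVars M K := by
        have := (finProdFinEquiv (a, i')).2
        simp only [guessVars, mem_filter, mem_univ, true_and, label, rank]
        omega
      have h1 : label (pickNbr a i') = label (pickNbr a i) ↔ i' = i :=
        ⟨fun h => by simpa using eq_of_label_eq h rfl, fun h => h ▸ rfl⟩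
      have h2 : label (pickNbr a i') ≠ label (pick a : SearchNode M K) :=
        fun h => by simpa using eq_of_label_eq h rfl
      simp [v, hmem, h1, h2]
    refine ⟨v, hv, (hpick v 0).2 ⟨a, Fin.zero_le a, fun l _ hl => ?_, ?_, ?_⟩⟩
    · exact (hv1 l).trans (by simp [hl.ne])
    · exact (hv1 a).trans (by simp)
    · refine (evalFrom_left_searchDiagram N hN v a).2 ⟨(hv (leftVar a)).trans ha, ?_⟩
      refine (hnbr v a 0).2 ⟨i, Fin.zero_le i, fun l _ hl => ?_, ?_, ?_⟩
      · exact (hv2 l).trans (by simp [hl.ne])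
      · exact (hv2 i).trans (by simp)
      · rw [evalFrom_right_searchDiagram]
        exact (hv (rightVar (N a i))).trans hb

end SearchDiagram

/-! ### Exponential lower bounds and their consequences -/

open SearchNode in
theorem exists_weakWidth_three_two_pow_le_size (n : ℕ) (hn : 1 ≤ n) :
    ∃ N : ℕ, N ≤ 32259 * n ∧ ∃ D : OBDD (Fin N), D.weakWidth = 3 ∧
      ∃ Z : Finset (Fin N), ∀ D' : OBDD {v : Fin N // v ∉ Z},
        ComputesNotExists D Z D' → 2 ^ n ≤ D'.size := by
  obtain ⟨N, hN, hmatch⟩ := exists_graph_with_induced_matchings n hn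
  have : NeZero (1344 * n) := ⟨by omega⟩
  refine ⟨3 + 3 * (1344 * n) + 1344 * n * 21, by omega, searchDiagram N hN,
    weakWidth_searchDiagram N hN, guessVars _ _, fun D' hD' => ?_⟩
  have h2 : 1344 * n = 2 * (672 * n) := by ring
  generalize 1344 * n = M at *
  subst h2
  refine D'.two_pow_le_size hmatch leftVar_injective rightVar_injective leftVar_ne_rightVar
    fun w => ?_
  rw [hD' w, Bool.not_eq_true', ← Bool.not_eq_true, existsProj_searchDiagram]
  push Not
  rfl

/-- An exponential function exceeds every polynomial in `n`. -/
theorem exists_mul_pow_lt_two_pow (G A k : ℕ) : ∃ n : ℕ, 1 ≤ n ∧ G * (A * n) ^ k < 2 ^ n := by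
  have h := (tendsto_pow_const_div_const_pow_of_one_lt k (one_lt_two (α := ℝ))).const_mul
    ((G : ℝ) * (A : ℝ) ^ k)
  rw [mul_zero] at h
  obtain ⟨n, hn, hn1⟩ := ((h.eventually_lt_const one_pos).and
    (Filter.eventually_ge_atTop 1)).exists
  refine ⟨n, hn1, ?_⟩
  rw [← mul_div_assoc, div_lt_one (by positivity)] at hn
  rw [mul_pow, ← mul_assoc]
  exact_mod_cast hn

theorem mainTheorem9 :
    (∃ C : ℕ, ∃ c : ℝ, 0 < c ∧ ∀ n : ℕ, 1 ≤ n →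
      ∃ N : ℕ, N ≤ C * n ∧ ∃ D : OBDD (Fin N), D.weakWidth = 3 ∧
        ∃ Z : Finset (Fin N), ∀ D' : OBDD {v : Fin N // v ∉ Z},
          ComputesNotExists D Z D' → (2 : ℝ) ^ (c * (n : ℝ)) ≤ (D'.size : ℝ)) ∧
    (¬ ∃ (g : ℕ → ℕ) (k : ℕ), ∀ (N : ℕ) (D : OBDD (Fin N)) (Z : Finset (Fin N)),
      ∃ D' : OBDD {v : Fin N // v ∉ Z},
        ComputesNotExists D Z D' ∧ D'.size ≤ g D.weakWidth * D.size ^ k) ∧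
    (¬ ∃ g : ℕ → ℕ, ∀ (N : ℕ) (D : OBDD (Fin N)) (Z : Finset (Fin N)),
      ∃ D' : OBDD {v : Fin N // v ∉ Z},
        ComputesNotExists D Z D' ∧ D'.weakWidth ≤ g D.weakWidth) := by
  refine ⟨⟨32259, 1, one_pos, fun n hn => ?_⟩, ?_, ?_⟩
  · obtain ⟨N, hN, D, hD, Z, h⟩ := exists_weakWidth_three_two_pow_le_size n hn
    refine ⟨N, hN, D, hD, Z, fun D' hD' => ?_⟩
    rw [one_mul, Real.rpow_natCast]
    exact_mod_cast h D' hD'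
  · rintro ⟨g, k, hg⟩
    obtain ⟨n, hn, hlt⟩ := exists_mul_pow_lt_two_pow (g 3) (32259 * 3 + 2) k
    obtain ⟨N, hN, D, hD, Z, h⟩ := exists_weakWidth_three_two_pow_le_size n hn
    obtain ⟨D', hD', hsize⟩ := hg N D Z
    rw [hD] at hsize
    have hDsize := D.size_le_card_mul_weakWidth
    rw [hD, Fintype.card_fin] at hDsize
    have : g 3 * D.size ^ k ≤ g 3 * ((32259 * 3 + 2) * n) ^ k := by
      gcongr
      omega
    exact absurd (((h D' hD').trans hsize).trans this) (not_le.2 hlt)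
  · rintro ⟨g, hg⟩
    obtain ⟨n, hn, hlt⟩ := exists_mul_pow_lt_two_pow 1 (32259 * g 3 + 2) 1
    obtain ⟨N, hN, D, hD, Z, h⟩ := exists_weakWidth_three_two_pow_le_size n hn
    obtain ⟨D', hD', hwidth⟩ := hg N D Z
    rw [hD] at hwidth
    have hcard : Fintype.card {v : Fin N // v ∉ Z} ≤ 32259 * n :=
      (Fintype.card_subtype_le _).trans (by simpa using hN)
    have : D'.size ≤ (32259 * g 3 + 2) * n :=
      calc D'.size ≤ _ := D'.size_le_card_mul_weakWidth
        _ ≤ 32259 * n * g 3 + 2 * n := by gcongr; omega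
        _ = _ := by ring
    rw [one_mul, pow_one] at hlt
    exact absurd ((h D' hD').trans this) (not_le.2 hlt)
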